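/- Let $K$ be a field and let $\mathbf a: a_1,\dots,a_n$ ($n\ge 1$) be a sequence of distinct positive integers with $\gcd(a_1,\dots,a_n)=1$ and $a_n>a_i$ for all $i<n$. Let $\mathbf a': a_n-a_1,\dots,a_n-a_{n-1},a_n$ be the dual sequence, and let $H$ and $H'$ be the numerical semigroups (submonoids of $\mathbb N$) generated by $\mathbf a$ and $\mathbf a'$. Notation. Let $S=K[x_1,\dots,x_n]$. For a sequence $\mathbf b: b_1,\dots,b_n$ let $I(\mathbf b)$ be the kernel of the $K$-algebra map $S\to K[t]$, $x_i\mapsto t^{b_i}$, and let $\deg_{\mathbf b}(x_1^{r_1}\cdots x_n^{r_n})=\sum_i r_ib_i$. Let $I(\mathbf a)^h\subset S[x_0]$ be the homogenization of $I(\mathbf a)$ with respect to $x_0$, i.e. the ideal generated by the homogenizations of all elements of $I(\mathbf a)$. The projective monomial curve $\overline{C(\mathbf a)}\subset\mathbb P^n$ is called arithmetically Cohen-Macaulay if $S[x_0]/I(\mathbf a)^h$ is a Cohen-Macaulay ring, i.e. a Noetherian ring whose localization at every maximal ideal has depth equal to its Krull dimension. Order the monomials of $S$ by the (degree) reverse lexicographic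 order with $x_1>\dots>x_n$: $x^\alpha<x^\beta$ if and only if $|\alpha|<|\beta|$, or $|\alpha|=|\beta|$ and $\alpha_i>\beta_i$ for the largest index $i$ with $\alpha_i\ne\beta_i$. For an ideal $J\subset S$ let $\operatorname{in}(J)$ be the ideal generated by the initial terms of the elements of $J$, and for a monomial ideal $L$ let $\operatorname{Mon}(S/L)$ be the set of monomials of $S$ not in $L$. For a numerical semigroup $G$ and $0\ne g\in G$ let $\operatorname{Ap}(G,g)=\{x\in G: x-g\notin G\}$. For $h\in\operatorname{Ap}(H,a_n)$ let $\varphi_{\mathbf a}(h)$ be the smallest monomial of $S$ whose $\mathbf a$-degree equals $h$. Then the following statements are equivalent: (a) the projective monomial curve $\overline{C(\mathbf a)}$ is arithmetically Cohen-Macaulay; (b) $\operatorname{in}(x_n,I(\mathbf a))=\operatorname{in}(x_n,I(\mathbf a'))$; (c) $\operatorname{Mon}(S/\operatorname{in}(x_n,I(\mathbf a)))=\operatorname{Mon}(S/\operatorname{in}(x_n,I(\mathbf a')))$; (d) $\deg_{\mathbf a'}(\varphi_{\mathbf a}(h))\in\operatorname{Ap}(H',a_n)$ for all $h\in\operatorname{Ap}(H,a_n)$.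 -/

import Mathlib

namespace ProjMonCurve

section CohenMacaulay

/-- The depth of a local ring: the supremum of the lengths of the regular sequences contained
in the maximal ideal. -/
noncomputable def localDepth (R : Type*) [CommRing R] [IsLocalRing R] : ℕ∞ :=
  ⨆ (rs : List R) (_ : RingTheory.Sequence.IsRegular R rs)
    (_ : ∀ r ∈ rs, r ∈ IsLocalRing.maximalIdeal R), (rs.length : ℕ∞)

/-- A Noetherian ring is Cohen-Macaulay if its localization at every maximal ideal has depth
equal to its Krull dimension. -/
structure IsCohenMacaulayRing (R : Type*) [CommRing R] : Prop where
  isNoetherianRing : IsNoetherianRing R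
  depth_eq_dim : ∀ (𝔪 : Ideal R) [𝔪.IsMaximal],
    (localDepth (Localization.AtPrime 𝔪) : WithBot ℕ∞) = ringKrullDim (Localization.AtPrime 𝔪)

/-- An ideal `J` of `R` is a Cohen-Macaulay ideal if `R/J` is a Cohen-Macaulay ring. -/
def IsCohenMacaulayIdeal {R : Type*} [CommRing R] (J : Ideal R) : Prop :=
  IsCohenMacaulayRing (R ⧸ J)

end CohenMacaulay

section RevLex

/-- Exponent vectors of monomials in `x₁, …, x_k`, to be ordered by the (degree) reverse
lexicographic order with `x₁ > x₂ > … > x_k`. -/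
def DegRevLex (k : ℕ) : Type := Fin k →₀ ℕ

noncomputable instance (k : ℕ) : AddCommMonoid (DegRevLex k) :=
  inferInstanceAs (AddCommMonoid (Fin k →₀ ℕ))

/-- The additive identification of exponent vectors with `DegRevLex k`. -/
noncomputable def toDegRevLex (k : ℕ) : (Fin k →₀ ℕ) ≃+ DegRevLex k := AddEquiv.refl _

/-- Comparison key: first the total degree, then the exponents read from the last variable to
the first one, each of them compared in reverse. -/
noncomputable def degRevLexKey (k : ℕ) (α : DegRevLex k) : ℕ ×ₗ Lex ((Fin k)ᵒᵈ → ℕᵒᵈ) :=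
  toLex (((toDegRevLex k).symm α).degree,
    toLex fun i => OrderDual.toDual ((toDegRevLex k).symm α (OrderDual.ofDual i)))

theorem degRevLexKey_injective (k : ℕ) : Function.Injective (degRevLexKey k) := by
  intro α β h
  apply (toDegRevLex k).symm.injective
  ext i
  have h2 := congrArg Prod.snd (toLex.injective h)
  exact OrderDual.toDual.injective (congrFun (toLex.injective h2) (OrderDual.toDual i))

noncomputable instance (k : ℕ) : LinearOrder (DegRevLex k) :=
  LinearOrder.lift' (degRevLexKey k) (degRevLexKey_injective k)

/-- `x^α < x^β` iff `deg x^α < deg x^β`, or the degrees agree and at the last variable where the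
exponents differ, `x^α` has the larger exponent. -/
theorem toDegRevLex_lt_iff {k : ℕ} {α β : Fin k →₀ ℕ} :
    toDegRevLex k α < toDegRevLex k β ↔ α.degree < β.degree ∨
      (α.degree = β.degree ∧ ∃ i, (∀ j, i < j → α j = β j) ∧ β i < α i) := by
  change degRevLexKey k (toDegRevLex k α) < degRevLexKey k (toDegRevLex k β) ↔ _
  rw [degRevLexKey, degRevLexKey, Prod.Lex.toLex_lt_toLex]
  exact Iff.rfl

theorem toDegRevLex_le_iff {k : ℕ} {α β : Fin k →₀ ℕ} :
    toDegRevLex k α ≤ toDegRevLex k β ↔ α = β ∨ toDegRevLex k α < toDegRevLex k β := by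
  rw [le_iff_eq_or_lt, (toDegRevLex k).injective.eq_iff]

instance (k : ℕ) : IsOrderedAddMonoid (DegRevLex k) where
  add_le_add_left a b h c := by
    obtain ⟨α, rfl⟩ := (toDegRevLex k).surjective a
    obtain ⟨β, rfl⟩ := (toDegRevLex k).surjective b
    obtain ⟨γ, rfl⟩ := (toDegRevLex k).surjective c
    rw [← map_add, ← map_add]
    rw [toDegRevLex_le_iff, toDegRevLex_lt_iff] at h ⊢
    simpa using h

instance (k : ℕ) : WellFoundedLT (DegRevLex k) := by
  refine ⟨Subrelation.wf (fun {a b} h => ?_) (measure fun b : DegRevLex k => (Set.Iio b).ncard).wf⟩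
  refine Set.ncard_lt_ncard ⟨fun x hx => lt_trans hx h, fun hs => lt_irrefl a (hs h)⟩ ?_
  obtain ⟨β, rfl⟩ := (toDegRevLex k).surjective b
  refine ((Finsupp.finite_of_degree_le (σ := Fin k) β.degree).image (toDegRevLex k)).subset ?_
  intro x hx
  obtain ⟨ξ, rfl⟩ := (toDegRevLex k).surjective x
  rw [Set.mem_Iio, toDegRevLex_lt_iff] at hx
  exact ⟨ξ, hx.elim le_of_lt fun h => le_of_eq h.1, rfl⟩

/-- The reverse lexicographic monomial order on `K[x₁, …, x_k]` with `x₁ > x₂ > … > x_k`. -/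
noncomputable def degRevLex (k : ℕ) : MonomialOrder (Fin k) where
  syn := DegRevLex k
  toSyn := toDegRevLex k
  toSyn_monotone a b h := by
    obtain ⟨c, rfl⟩ := exists_add_of_le h
    rw [toDegRevLex_le_iff, toDegRevLex_lt_iff]
    by_cases hc : c = 0
    · left; simp [hc]
    · right; left
      have : 0 < c.degree := Nat.pos_of_ne_zero (by rwa [Ne, Finsupp.degree_eq_zero_iff])
      rw [map_add]; omega

end RevLex

open MvPolynomial

/-- The initial ideal of `J`: the ideal generated by the initial terms of the elements
of `J`. -/
noncomputable def initialIdeal {σ K : Type*} [Field K] (m : MonomialOrder σ)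
    (J : Ideal (MvPolynomial σ K)) : Ideal (MvPolynomial σ K) :=
  Ideal.span (m.leadingTerm '' (J : Set (MvPolynomial σ K)))

/-- The monomials (exponent vectors) outside the ideal `J`; for a monomial ideal `J` their classes
are the monomial `K`-basis `Mon(S/J)` of `S/J`. -/
def standardMonomials {σ K : Type*} [Field K] (J : Ideal (MvPolynomial σ K)) : Set (σ →₀ ℕ) :=
  {α | monomial α (1 : K) ∉ J}

/-- `I(a)`, the kernel of `K[x₁, …, x_k] → K[t]`, `x_i ↦ t^{a_i}`. -/
noncomputable def toricIdeal (K : Type*) [Field K] {k : ℕ} (a : Fin k → ℕ) :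
    Ideal (MvPolynomial (Fin k) K) :=
  RingHom.ker (aeval fun i => (Polynomial.X : Polynomial K) ^ a i)

/-- The homogenization `f^h` of `f ∈ K[x₁, …, x_k]` with respect to a new variable `x₀`. The
variable `x₀` has index `0` and the old variable with index `i` gets the index `i.succ`. -/
noncomputable def homogenization {K : Type*} [Field K] {k : ℕ} (f : MvPolynomial (Fin k) K) :
    MvPolynomial (Fin (k + 1)) K :=
  ∑ α ∈ f.support, monomial (Finsupp.cons (f.totalDegree - α.degree) α) (f.coeff α)

/-- The homogenization `J^h` of the ideal `J`: the ideal generated by all `f^h`, `f ∈ J`. -/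
noncomputable def idealHomogenization {K : Type*} [Field K] {k : ℕ}
    (J : Ideal (MvPolynomial (Fin k) K)) : Ideal (MvPolynomial (Fin (k + 1)) K) :=
  Ideal.span (homogenization '' (J : Set (MvPolynomial (Fin k) K)))

/-- The projective monomial curve of the sequence `a` (over `K`) is arithmetically Cohen-Macaulay:
its vanishing ideal `I(a)^h` is a Cohen-Macaulay ideal. -/
def IsArithmeticallyCohenMacaulay (K : Type*) [Field K] {k : ℕ} (a : Fin k → ℕ) : Prop :=
  IsCohenMacaulayIdeal (idealHomogenization (toricIdeal K a))

/-- The dual sequence `a_n - a_1, …, a_n - a_{n-1}, a_n`. -/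
def dualSeq {m : ℕ} (a : Fin (m + 1) → ℕ) : Fin (m + 1) → ℕ :=
  fun i => if i = Fin.last m then a (Fin.last m) else a (Fin.last m) - a i

/-- The numerical semigroup (with `0`) generated by the sequence `a`. -/
def semigroupOf {k : ℕ} (a : Fin k → ℕ) : AddSubmonoid ℕ :=
  AddSubmonoid.closure (Set.range a)

/-- The Apéry set `{x ∈ H : x - h ∉ H}`, the difference being taken in `ℤ`. -/
def aperySet (H : AddSubmonoid ℕ) (h : ℕ) : Set ℕ :=
  {x | x ∈ H ∧ ∀ y ∈ H, (y : ℤ) ≠ (x : ℤ) - (h : ℤ)}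

/-- The `a`-degree `∑ rᵢ aᵢ` of the monomial with exponents `rᵢ`. -/
def seqDegree {k : ℕ} (a : Fin k → ℕ) (α : Fin k →₀ ℕ) : ℕ := ∑ i, α i * a i

theorem exists_seqDegree_eq {k : ℕ} (a : Fin k → ℕ) {h : ℕ} (hh : h ∈ semigroupOf a) :
    {α : Fin k →₀ ℕ | seqDegree a α = h}.Nonempty := by
  obtain ⟨r, hr⟩ := AddSubmonoid.mem_closure_range_iff_of_fintype.mp hh
  exact ⟨Finsupp.equivFunOnFinite.symm r, by simpa [seqDegree] using hr.symm⟩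

/-- `φ_a(h)`: the smallest monomial, in the reverse lexicographic order, of `a`-degree `h`. -/
noncomputable def smallestMonomial {k : ℕ} (a : Fin k → ℕ) (h : ℕ) (hh : h ∈ semigroupOf a) :
    Fin k →₀ ℕ :=
  Function.argminOn (degRevLex k).toSyn {α | seqDegree a α = h} (exists_seqDegree_eq a hh)

end ProjMonCurve

open ProjMonCurve

/-! Write d = a_n. Everything passes through one condition, `LengthIncreases`: adding d to an
element of H raises its least factorization length (then necessarily by exactly one).

For (d), entries and dual entries sum to d, so deg_a + deg_a' of a monomial free of x_n is d times
its length. A factorization over a' of deg_a'(φ_a(h)) - d thus becomes a factorization over a of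
some h + jd that is too short (`forall_dualSeq_mem_aperySet_iff_lengthIncreases`).

For (b) and (c), the standard monomials modulo (x_n, I(a)) are the φ_a(h) with h in the Apéry set
(`mem_standardMonomials_iff`). There is one per residue class mod d for each sequence, so the
inclusion given by (d) is an equality (`forall_isAperyMinimal_dualSeq_iff`).

For (a), x_0 ↦ s, x_i ↦ s t^{a_i} embeds the coordinate ring in K[s][t], with image spanned by the
s^n t^h, h in H, n at least the least length of h (`ker_projParam`, `mem_range_projParam_iff`). If
lengths grow, monic polynomials in x_0 and in x_n form regular sequences, giving depth two at every
maximal ideal. If growth fails at h of least length l + 1, the fraction s^l t^h lies outside the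
ring although x_0 and x_n multiply it into the ring; this contradicts depth two at the vertex. -/

namespace ProjMonCurve

/-! ### Factorizations, Apéry sets and duality. -/

section Combinatorics

variable {k m : ℕ}

theorem seqDegree_add (a : Fin k → ℕ) (α β : Fin k →₀ ℕ) :
    seqDegree a (α + β) = seqDegree a α + seqDegree a β := by
  simp [seqDegree, add_mul, Finset.sum_add_distrib]

@[simp]
theorem seqDegree_zero (a : Fin k → ℕ) : seqDegree a 0 = 0 := by
  simp [seqDegree]

@[simp]
theorem seqDegree_single (a : Fin k → ℕ) (i : Fin k) (r : ℕ) :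
    seqDegree a (Finsupp.single i r) = r * a i := by
  simp [seqDegree, Finsupp.single_apply]

theorem mem_semigroupOf_iff {a : Fin k → ℕ} {h : ℕ} :
    h ∈ semigroupOf a ↔ ∃ α, seqDegree a α = h := by
  refine ⟨fun hh => exists_seqDegree_eq a hh, ?_⟩
  rintro ⟨α, rfl⟩
  exact AddSubmonoid.mem_closure_range_iff_of_fintype.mpr ⟨α, by simp [seqDegree]⟩

theorem seqDegree_mem_semigroupOf (a : Fin k → ℕ) (α : Fin k →₀ ℕ) :
    seqDegree a α ∈ semigroupOf a :=
  mem_semigroupOf_iff.mpr ⟨α, rfl⟩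

theorem mem_aperySet_iff {a : Fin k → ℕ} {d x : ℕ} :
    x ∈ aperySet (semigroupOf a) d ↔
      x ∈ semigroupOf a ∧ ∀ α, seqDegree a α + d ≠ x := by
  refine and_congr_right fun _ => ⟨fun h α e => ?_, fun h y hy e => ?_⟩
  · exact h _ (seqDegree_mem_semigroupOf a α) (by omega)
  · obtain ⟨α, rfl⟩ := mem_semigroupOf_iff.mp hy
    exact h α (by omega)

/-- The exponent vector `α` is the smallest one of its `a`-degree, and this degree lies in the
Apéry set of the last entry of `a`. -/
def IsAperyMinimal (a : Fin (m + 1) → ℕ) (α : Fin (m + 1) →₀ ℕ) : Prop :=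
  seqDegree a α ∈ aperySet (semigroupOf a) (a (Fin.last m)) ∧
    ∀ β, seqDegree a β = seqDegree a α → toDegRevLex _ α ≤ toDegRevLex _ β

theorem seqDegree_smallestMonomial (a : Fin k → ℕ) {h : ℕ} (hh : h ∈ semigroupOf a) :
    seqDegree a (smallestMonomial a h hh) = h :=
  Function.argminOn_mem (degRevLex k).toSyn _ (exists_seqDegree_eq a hh)

theorem smallestMonomial_le (a : Fin k → ℕ) {h : ℕ} (hh : h ∈ semigroupOf a) {β : Fin k →₀ ℕ}
    (hβ : seqDegree a β = h) :
    toDegRevLex k (smallestMonomial a h hh) ≤ toDegRevLex k β :=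
  Function.argminOn_le (degRevLex k).toSyn {α | seqDegree a α = h} hβ

theorem isAperyMinimal_smallestMonomial (a : Fin (m + 1) → ℕ) {h : ℕ}
    (hh : h ∈ aperySet (semigroupOf a) (a (Fin.last m))) :
    IsAperyMinimal a (smallestMonomial a h hh.1) := by
  rw [IsAperyMinimal, seqDegree_smallestMonomial]
  exact ⟨hh, fun β hβ => smallestMonomial_le a hh.1 hβ⟩

theorem IsAperyMinimal.eq_of_seqDegree_eq {a : Fin (m + 1) → ℕ} {α β : Fin (m + 1) →₀ ℕ}
    (hα : IsAperyMinimal a α) (hβ : IsAperyMinimal a β) (h : seqDegree a α = seqDegree a β) :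
    α = β :=
  (toDegRevLex _).injective (le_antisymm (hα.2 β h.symm) (hβ.2 α h))

theorem degree_le_of_toDegRevLex_le {α β : Fin k →₀ ℕ} (h : toDegRevLex k α ≤ toDegRevLex k β) :
    α.degree ≤ β.degree := by
  rw [toDegRevLex_le_iff, toDegRevLex_lt_iff] at h
  rcases h with rfl | h | h
  · rfl
  · exact h.le
  · exact h.1.le

theorem forall_aperySet_iff (a : Fin (m + 1) → ℕ) (P : (Fin (m + 1) →₀ ℕ) → Prop) :
    (∀ (h : ℕ) (hh : h ∈ aperySet (semigroupOf a) (a (Fin.last m))),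
      P (smallestMonomial a h hh.1)) ↔ ∀ α, IsAperyMinimal a α → P α := by
  refine ⟨fun H α hα => ?_, fun H h hh => H _ (isAperyMinimal_smallestMonomial a hh)⟩
  have := H _ hα.1
  rwa [(isAperyMinimal_smallestMonomial a hα.1).eq_of_seqDegree_eq hα
    (seqDegree_smallestMonomial a _)] at this

/-- Splitting off the power of the last variable. -/
theorem exists_eq_add_single_last (α : Fin (m + 1) →₀ ℕ) :
    ∃ β, β (Fin.last m) = 0 ∧ α = β + Finsupp.single (Fin.last m) (α (Fin.last m)) :=
  ⟨α.erase (Fin.last m), by simp, (Finsupp.erase_add_single _ _).symm⟩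

theorem apply_last_eq_zero_of_mem_aperySet {a : Fin (m + 1) → ℕ} {α : Fin (m + 1) →₀ ℕ}
    (hα : seqDegree a α ∈ aperySet (semigroupOf a) (a (Fin.last m))) : α (Fin.last m) = 0 := by
  obtain ⟨β, -, hβ⟩ := exists_eq_add_single_last α
  generalize α (Fin.last m) = e at hβ
  cases e with
  | zero => rfl
  | succ e =>
    refine absurd ?_ ((mem_aperySet_iff.mp hα).2 (β + Finsupp.single (Fin.last m) e))
    rw [hβ, seqDegree_add, seqDegree_add, seqDegree_single, seqDegree_single]
    ring

theorem eq_zero_of_mem_aperySet {a : Fin (m + 1) → ℕ} {α : Fin (m + 1) →₀ ℕ} {x n : ℕ}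
    (hx : x ∈ aperySet (semigroupOf a) (a (Fin.last m)))
    (h : seqDegree a α + n * a (Fin.last m) = x) : n = 0 := by
  cases n with
  | zero => rfl
  | succ n =>
    refine absurd ?_ ((mem_aperySet_iff.mp hx).2 (α + Finsupp.single (Fin.last m) n))
    rw [← h, seqDegree_add, seqDegree_single]
    ring

/-- Subtract a_n as long as the result stays in the semigroup; positivity of a_n makes this stop, in
the Apéry set. -/
theorem exists_isAperyMinimal {a : Fin (m + 1) → ℕ} (hd : 0 < a (Fin.last m))
    (γ : Fin (m + 1) →₀ ℕ) :
    ∃ α n, IsAperyMinimal a α ∧ seqDegree a γ = seqDegree a α + n * a (Fin.last m) := by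
  induction h : seqDegree a γ using Nat.strong_induction_on generalizing γ with
  | _ x ih =>
    subst h
    by_cases hγ : seqDegree a γ ∈ aperySet (semigroupOf a) (a (Fin.last m))
    · exact ⟨_, 0, isAperyMinimal_smallestMonomial a hγ, by rw [seqDegree_smallestMonomial]; simp⟩
    · rw [mem_aperySet_iff] at hγ
      push Not at hγ
      obtain ⟨β, hβ⟩ := hγ (seqDegree_mem_semigroupOf a γ)
      obtain ⟨α, n, hα, hn⟩ := ih _ (by omega) β rfl
      exact ⟨α, n + 1, hα, by rw [← hβ, hn]; ring⟩

theorem dualSeq_last (a : Fin (m + 1) → ℕ) : dualSeq a (Fin.last m) = a (Fin.last m) := by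
  simp [dualSeq]

/-- Entry plus dual entry is a_n, except at the last index, where it is 2a_n; this accounts for the
extra term. -/
theorem seqDegree_dualSeq_add {a : Fin (m + 1) → ℕ} (ha : ∀ i, a i ≤ a (Fin.last m))
    (α : Fin (m + 1) →₀ ℕ) :
    seqDegree (dualSeq a) α + seqDegree a α =
      α.degree * a (Fin.last m) + α (Fin.last m) * a (Fin.last m) := by
  have : ∀ i, dualSeq a i + a i =
      a (Fin.last m) + if i = Fin.last m then a (Fin.last m) else 0 := by
    intro i
    have := ha i
    rw [dualSeq]
    split_ifs with h
    · rw [h]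
    · omega
  simp_rw [seqDegree, ← Finset.sum_add_distrib, ← mul_add, this, mul_add,
    Finset.sum_add_distrib, ← Finset.sum_mul, Finsupp.degree_eq_sum]
  simp

/-- For every `h` in the semigroup, the least length of a factorization of `h + a_n` exceeds the
least length of a factorization of `h`. -/
def LengthIncreases (a : Fin (m + 1) → ℕ) : Prop :=
  ∀ γ β, seqDegree a β = seqDegree a γ + a (Fin.last m) →
    ∃ α, seqDegree a α = seqDegree a γ ∧ α.degree < β.degree

theorem LengthIncreases.iterate {a : Fin (m + 1) → ℕ} (H : LengthIncreases a) (n : ℕ)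
    (γ β : Fin (m + 1) →₀ ℕ) (h : seqDegree a β = seqDegree a γ + n * a (Fin.last m)) :
    ∃ α, seqDegree a α = seqDegree a γ ∧ α.degree + n ≤ β.degree := by
  induction n generalizing β with
  | zero => exact ⟨β, by simpa using h, le_rfl⟩
  | succ n ih =>
    obtain ⟨β', hβ', hlt⟩ := H (γ + Finsupp.single (Fin.last m) n) β (by
      rw [h, seqDegree_add, seqDegree_single]; ring)
    rw [seqDegree_add, seqDegree_single] at hβ'
    obtain ⟨α, hα, hle⟩ := ih β' hβ'
    exact ⟨α, hα, by omega⟩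

theorem forall_dualSeq_mem_aperySet_iff_lengthIncreases {a : Fin (m + 1) → ℕ}
    (hd : 0 < a (Fin.last m)) (ha : ∀ i, a i ≤ a (Fin.last m)) :
    (∀ α, IsAperyMinimal a α →
      seqDegree (dualSeq a) α ∈ aperySet (semigroupOf (dualSeq a)) (a (Fin.last m))) ↔
    LengthIncreases a := by
  constructor
  · intro H γ β hβ
    by_contra! hno
    obtain ⟨α, n, hα, hn⟩ := exists_isAperyMinimal hd γ
    have h1 := hno (α + Finsupp.single (Fin.last m) n)
      (by rw [seqDegree_add, seqDegree_single, hn])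
    rw [map_add, Finsupp.degree_single] at h1
    obtain ⟨β₀, hβ₀, hβe⟩ := exists_eq_add_single_last β
    obtain ⟨c, hc⟩ := Nat.exists_eq_add_of_le h1
    -- The slack `c` in the length inequality serves as the exponent of x_n in a dual factorization
    -- of deg_a'(α) - a_n.
    refine (mem_aperySet_iff.mp (H α hα)).2 (β₀ + Finsupp.single (Fin.last m) c) ?_
    have e1 := seqDegree_dualSeq_add ha α
    have e2 := seqDegree_dualSeq_add ha β₀
    rw [apply_last_eq_zero_of_mem_aperySet hα.1] at e1
    rw [hβ₀] at e2
    generalize β (Fin.last m) = e at hβe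
    rw [hβe, map_add, Finsupp.degree_single] at hc
    rw [hβe, hn, seqDegree_add, seqDegree_single] at hβ
    rw [seqDegree_add, seqDegree_single, dualSeq_last]
    zify at *
    linear_combination e2 - e1 - hβ - (a (Fin.last m) : ℤ) * hc
  · intro H α hα
    rw [mem_aperySet_iff]
    refine ⟨seqDegree_mem_semigroupOf _ _, fun β hβ => ?_⟩
    obtain ⟨β₀, hβ₀, hβe⟩ := exists_eq_add_single_last β
    have e1 := seqDegree_dualSeq_add ha α
    have e2 := seqDegree_dualSeq_add ha β₀
    rw [apply_last_eq_zero_of_mem_aperySet hα.1] at e1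
    rw [hβ₀] at e2
    generalize β (Fin.last m) = e at hβe
    rw [hβe, seqDegree_add, seqDegree_single, dualSeq_last] at hβ
    -- The a-degrees of `β₀` and `α` differ by (|β₀| + e + 1 - |α|)·a_n, of either sign. If it is
    -- nonnegative, growth of lengths bounds |β₀| below; if not, padding `β₀` with x_n gives a
    -- factorization shorter than the minimal `α`.
    rcases Nat.le_total α.degree (β₀.degree + e + 1) with hle | hle
    · obtain ⟨j, hj⟩ := Nat.exists_eq_add_of_le hle
      obtain ⟨α', hα', hlen⟩ := H.iterate j α β₀ (by
        zify at *
        linear_combination e2 - e1 - hβ + (a (Fin.last m) : ℤ) * hj)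
      have := degree_le_of_toDegRevLex_le (hα.2 α' hα')
      omega
    · obtain ⟨j, hj⟩ := Nat.exists_eq_add_of_le hle
      have := degree_le_of_toDegRevLex_le (hα.2 (β₀ + Finsupp.single (Fin.last m) j) (by
        rw [seqDegree_add, seqDegree_single]
        zify at *
        linear_combination e2 - e1 - hβ - (a (Fin.last m) : ℤ) * hj))
      rw [map_add, Finsupp.degree_single] at this
      omega

/-- A competitor smaller than `α` of the same a'-degree is no longer than `α`, so its a-degree is
that of `α` minus a multiple of a_n; the Apéry property makes the multiple zero, against minimality
for a. Conversely, an exponent minimal for a' is compared with the one minimal for a in its residue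
class mod a_n. -/
theorem forall_isAperyMinimal_dualSeq_iff {a : Fin (m + 1) → ℕ}
    (hd : 0 < a (Fin.last m)) (ha : ∀ i, a i ≤ a (Fin.last m)) :
    (∀ α, IsAperyMinimal a α ↔ IsAperyMinimal (dualSeq a) α) ↔
    ∀ α, IsAperyMinimal a α →
      seqDegree (dualSeq a) α ∈ aperySet (semigroupOf (dualSeq a)) (a (Fin.last m)) := by
  constructor
  · intro H α hα
    simpa only [dualSeq_last] using ((H α).mp hα).1
  intro H
  have hlast := dualSeq_last a
  have key : ∀ α, IsAperyMinimal a α → IsAperyMinimal (dualSeq a) α := by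
    intro α hα
    have hα' := H α hα
    rw [← hlast] at hα'
    refine ⟨hα', fun β hβ => ?_⟩
    by_contra! hlt
    have hdeg := degree_le_of_toDegRevLex_le hlt.le
    obtain ⟨n, hn⟩ := Nat.exists_eq_add_of_le hdeg
    have e1 := seqDegree_dualSeq_add ha α
    have e2 := seqDegree_dualSeq_add ha β
    rw [apply_last_eq_zero_of_mem_aperySet hα.1] at e1
    rw [apply_last_eq_zero_of_mem_aperySet (hβ ▸ hα')] at e2
    have e3 : seqDegree a β + n * a (Fin.last m) = seqDegree a α := by
      zify at *
      linear_combination e2 - e1 - hβ - (a (Fin.last m) : ℤ) * hn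
    obtain rfl := eq_zero_of_mem_aperySet hα.1 e3
    exact absurd (hα.2 β (by simpa using e3)) hlt.not_ge
  refine fun α => ⟨key α, fun hα => ?_⟩
  obtain ⟨β, n, hβ, hn⟩ := exists_isAperyMinimal hd α
  have hβ' := key β hβ
  have e1 := seqDegree_dualSeq_add ha α
  have e2 := seqDegree_dualSeq_add ha β
  rw [apply_last_eq_zero_of_mem_aperySet hα.1] at e1
  rw [apply_last_eq_zero_of_mem_aperySet hβ.1] at e2
  suffices seqDegree (dualSeq a) α = seqDegree (dualSeq a) β by
    rwa [hα.eq_of_seqDegree_eq hβ' this]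
  -- Both a'-degrees are Apéry and congruent mod a_n; the Apéry property of the larger one forces
  -- equality.
  rcases Nat.le_total α.degree (β.degree + n) with hle | hle
  · obtain ⟨j, hj⟩ := Nat.exists_eq_add_of_le hle
    have e3 : seqDegree (dualSeq a) α + j * dualSeq a (Fin.last m) =
        seqDegree (dualSeq a) β := by
      rw [hlast]
      zify at *
      linear_combination e1 - e2 - hn - (a (Fin.last m) : ℤ) * hj
    obtain rfl := eq_zero_of_mem_aperySet hβ'.1 e3
    simpa using e3
  · obtain ⟨j, hj⟩ := Nat.exists_eq_add_of_le hle
    have e3 : seqDegree (dualSeq a) β + j * dualSeq a (Fin.last m) =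
        seqDegree (dualSeq a) α := by
      rw [hlast]
      zify at *
      linear_combination e2 - e1 + hn - (a (Fin.last m) : ℤ) * hj
    obtain rfl := eq_zero_of_mem_aperySet hα.1 e3
    simpa using e3.symm

end Combinatorics

/-! ### Initial ideals and standard monomials. -/

section InitialIdeals

open MvPolynomial

variable {σ K : Type*} [Field K]

theorem initialIdeal_eq_span_monomial (o : MonomialOrder σ) (J : Ideal (MvPolynomial σ K)) :
    initialIdeal o J =
      Ideal.span ((fun s => monomial s (1 : K)) '' {s | ∃ f ∈ J, f ≠ 0 ∧ o.degree f = s}) := by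
  apply le_antisymm
  · rw [initialIdeal, Ideal.span_le]
    rintro _ ⟨f, hf, rfl⟩
    by_cases h0 : f = 0
    · simp [h0]
    have : o.leadingTerm f = C (o.leadingCoeff f) * monomial (o.degree f) 1 := by
      rw [C_mul_monomial, mul_one]; rfl
    rw [SetLike.mem_coe, this]
    exact Ideal.mul_mem_left _ _ (Ideal.subset_span ⟨_, ⟨f, hf, h0, rfl⟩, rfl⟩)
  · rw [Ideal.span_le]
    rintro _ ⟨_, ⟨f, hf, h0, rfl⟩, rfl⟩
    have hc : o.leadingCoeff f ≠ 0 := o.leadingCoeff_ne_zero_iff.mpr h0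
    have : monomial (o.degree f) (1 : K) = C (o.leadingCoeff f)⁻¹ * o.leadingTerm f := by
      rw [MonomialOrder.leadingTerm, C_mul_monomial, inv_mul_cancel₀ hc]
    simp only [SetLike.mem_coe, this]
    exact Ideal.mul_mem_left _ _ (Ideal.subset_span ⟨f, hf, rfl⟩)

/-- A monomial in the ideal is a multiple of some leading monomial, and multiplying that polynomial
by the cofactor stays in `J`. -/
theorem monomial_mem_initialIdeal_iff {o : MonomialOrder σ} {J : Ideal (MvPolynomial σ K)}
    {α : σ →₀ ℕ} :
    monomial α (1 : K) ∈ initialIdeal o J ↔ ∃ f ∈ J, f ≠ 0 ∧ o.degree f = α := by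
  classical
  rw [initialIdeal_eq_span_monomial, mem_ideal_span_monomial_image]
  simp only [support_monomial, one_ne_zero, if_false, Finset.mem_singleton, forall_eq]
  constructor
  · rintro ⟨_, ⟨f, hf, h0, rfl⟩, hle⟩
    obtain ⟨γ, rfl⟩ := exists_add_of_le hle
    have hm : monomial γ (1 : K) ≠ 0 := by simp
    exact ⟨f * monomial γ 1, J.mul_mem_right _ hf, mul_ne_zero h0 hm, by
      rw [o.degree_mul h0 hm, o.degree_monomial]; simp⟩
  · rintro ⟨f, hf, h0, rfl⟩
    exact ⟨_, ⟨f, hf, h0, rfl⟩, le_rfl⟩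

theorem initialIdeal_eq_span_compl_standardMonomials (o : MonomialOrder σ)
    (J : Ideal (MvPolynomial σ K)) :
    initialIdeal o J =
      Ideal.span ((fun s => monomial s (1 : K)) '' (standardMonomials (initialIdeal o J))ᶜ) := by
  rw [initialIdeal_eq_span_monomial]
  congr 2
  ext α
  rw [← initialIdeal_eq_span_monomial, standardMonomials]
  simp [monomial_mem_initialIdeal_iff]

theorem initialIdeal_eq_iff_standardMonomials_eq {o : MonomialOrder σ}
    {J J' : Ideal (MvPolynomial σ K)} :
    initialIdeal o J = initialIdeal o J' ↔
      standardMonomials (initialIdeal o J) = standardMonomials (initialIdeal o J') := by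
  refine ⟨fun h => by rw [h], fun h => ?_⟩
  rw [initialIdeal_eq_span_compl_standardMonomials, h,
    ← initialIdeal_eq_span_compl_standardMonomials]

theorem aeval_X_pow_monomial {k : ℕ} (a : Fin k → ℕ) (α : Fin k →₀ ℕ) (c : K) :
    aeval (fun i => (Polynomial.X : Polynomial K) ^ a i) (monomial α c) =
      Polynomial.monomial (seqDegree a α) c := by
  rw [aeval_monomial, Finsupp.prod_fintype _ _ (by simp), ← Polynomial.C_mul_X_pow_eq_monomial]
  simp only [← pow_mul, Finset.prod_pow_eq_pow_sum, seqDegree, mul_comm]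
  rfl

theorem coeff_aeval_X_pow {k : ℕ} (a : Fin k → ℕ) (f : MvPolynomial (Fin k) K) (h : ℕ) :
    (aeval (fun i => (Polynomial.X : Polynomial K) ^ a i) f).coeff h =
      ∑ α ∈ f.support with seqDegree a α = h, f.coeff α := by
  conv_lhs => rw [f.as_sum, map_sum, Polynomial.finsetSum_coeff]
  simp_rw [aeval_X_pow_monomial, Polynomial.coeff_monomial, Finset.sum_filter]

theorem monomial_sub_mem_toricIdeal {k : ℕ} {a : Fin k → ℕ} {α β : Fin k →₀ ℕ}
    (h : seqDegree a α = seqDegree a β) :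
    monomial α (1 : K) - monomial β 1 ∈ toricIdeal K a := by
  rw [toricIdeal, RingHom.mem_ker]
  change aeval _ _ = _
  rw [map_sub, aeval_X_pow_monomial, aeval_X_pow_monomial, h, sub_self]

/-- The toric part maps to zero and a multiple of x_n to something supported in a_n + H, which
misses Apéry degrees. -/
theorem coeff_aeval_eq_zero_of_mem {m : ℕ} {a : Fin (m + 1) → ℕ} {h : ℕ}
    (hh : h ∈ aperySet (semigroupOf a) (a (Fin.last m))) {f : MvPolynomial (Fin (m + 1)) K}
    (hf : f ∈ Ideal.span {X (Fin.last m)} ⊔ toricIdeal K a) :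
    (aeval (fun i => (Polynomial.X : Polynomial K) ^ a i) f).coeff h = 0 := by
  obtain ⟨_, hg, g', hg', rfl⟩ := Submodule.mem_sup.mp hf
  obtain ⟨g, rfl⟩ := Ideal.mem_span_singleton'.mp hg
  have hg0 : aeval (fun i => (Polynomial.X : Polynomial K) ^ a i) g' = 0 := hg'
  rw [map_add, hg0, add_zero, map_mul, aeval_X, Polynomial.coeff_mul_X_pow']
  split_ifs with hle
  · rw [coeff_aeval_X_pow]
    refine Finset.sum_eq_zero fun α hα => ?_
    rw [Finset.mem_filter] at hα
    exact absurd (by omega) ((mem_aperySet_iff.mp hh).2 α)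
  · rfl

/-- A monomial of non-Apéry degree is congruent to a multiple of x_n, and a non-minimal one leads a
toric binomial. Conversely, if an Apéry-minimal monomial leads `f`, no other term of `f` shares its
a-degree, so the coefficient that must vanish is the leading one. -/
theorem mem_standardMonomials_iff {m : ℕ} (a : Fin (m + 1) → ℕ) (α : Fin (m + 1) →₀ ℕ) :
    α ∈ standardMonomials (initialIdeal (degRevLex (m + 1))
      (Ideal.span {X (Fin.last m)} ⊔ toricIdeal K a)) ↔ IsAperyMinimal a α := by
  classical
  rw [standardMonomials, Set.mem_ofPred_eq, monomial_mem_initialIdeal_iff]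
  constructor
  · intro H
    by_contra hα
    apply H
    rw [IsAperyMinimal, not_and_or, mem_aperySet_iff, not_and_or] at hα
    rcases hα with (hα | hα) | hα
    · exact absurd (seqDegree_mem_semigroupOf a α) hα
    · push Not at hα
      obtain ⟨β, hβ⟩ := hα
      refine ⟨monomial α 1, ?_, by simp, by rw [MonomialOrder.degree_monomial]; simp⟩
      have e : monomial α (1 : K) = monomial β 1 * X (Fin.last m) +
          (monomial α 1 - monomial (β + Finsupp.single (Fin.last m) 1) 1) := by
        rw [X, monomial_mul, mul_one]; ring
      rw [e]
      refine Ideal.add_mem _ (Ideal.mem_sup_left (Ideal.mul_mem_left _ _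
        (Ideal.mem_span_singleton_self _))) (Ideal.mem_sup_right (monomial_sub_mem_toricIdeal ?_))
      rw [seqDegree_add, seqDegree_single, one_mul, hβ]
    · push Not at hα
      obtain ⟨β, hβ, hlt⟩ := hα
      have hdeg : (degRevLex (m + 1)).degree (monomial α (1 : K) - monomial β 1) = α := by
        rw [MonomialOrder.degree_sub_of_lt]
        · rw [MonomialOrder.degree_monomial]; simp
        · rw [MonomialOrder.degree_monomial, MonomialOrder.degree_monomial]
          rw [if_neg one_ne_zero, if_neg one_ne_zero]
          exact hlt
      refine ⟨monomial α 1 - monomial β 1,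
        Ideal.mem_sup_right (monomial_sub_mem_toricIdeal hβ.symm), fun h0 => ?_, hdeg⟩
      have := (monomial_left_inj (one_ne_zero (α := K))).mp (sub_eq_zero.mp h0)
      exact hlt.ne (by rw [this])
  · rintro ⟨hα, hmin⟩ ⟨f, hf, h0, rfl⟩
    have h1 := coeff_aeval_eq_zero_of_mem hα hf
    rw [coeff_aeval_X_pow, Finset.sum_eq_single ((degRevLex (m + 1)).degree f)] at h1
    · exact (degRevLex (m + 1)).leadingCoeff_ne_zero_iff.mpr h0 h1
    · intro β hβ hne
      rw [Finset.mem_filter] at hβ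
      exact absurd ((toDegRevLex _).injective (le_antisymm
        ((degRevLex (m + 1)).le_degree hβ.1) (hmin β hβ.2))) hne
    · intro hnot
      rw [Finset.mem_filter] at hnot
      exact absurd ⟨(degRevLex (m + 1)).degree_mem_support h0, rfl⟩ hnot

end InitialIdeals

end ProjMonCurve

namespace ProjMonCurve

/-! ### The homogeneous parametrization, its kernel and its image. -/

section Parametrization

open MvPolynomial

variable {K : Type*} [Field K] {k : ℕ}

/-- The homogeneous parametrization `x₀ ↦ s`, `xᵢ ↦ s t^{a_i}` of the projective monomial curve,
with values in `K[s][t]`. -/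
noncomputable def projParam (K : Type*) [Field K] {k : ℕ} (a : Fin k → ℕ) :
    MvPolynomial (Fin (k + 1)) K →ₐ[K] Polynomial (Polynomial K) :=
  aeval (Fin.cons (Polynomial.C Polynomial.X) fun i =>
    Polynomial.C Polynomial.X * Polynomial.X ^ a i)

theorem projParam_X_zero (a : Fin k → ℕ) :
    projParam K a (X 0) = Polynomial.C Polynomial.X := by
  simp [projParam]

theorem projParam_X_succ (a : Fin k → ℕ) (i : Fin k) :
    projParam K a (X i.succ) = Polynomial.C Polynomial.X * Polynomial.X ^ a i := by
  simp [projParam]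

theorem degree_eq_zero_add_degree_tail (u : Fin (k + 1) →₀ ℕ) :
    u.degree = u 0 + u.tail.degree := by
  simp [Finsupp.degree_eq_sum, Fin.sum_univ_succ, Finsupp.tail_apply]

theorem projParam_monomial (a : Fin k → ℕ) (u : Fin (k + 1) →₀ ℕ) (c : K) :
    projParam K a (monomial u c) =
      Polynomial.monomial (seqDegree a u.tail) (Polynomial.monomial u.degree c) := by
  rw [projParam, aeval_monomial, Finsupp.prod_fintype _ _ (by simp), Fin.prod_univ_succ]
  simp only [Fin.cons_zero, Fin.cons_succ, mul_pow, ← pow_mul, Finset.prod_mul_distrib,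
    Finset.prod_pow_eq_pow_sum, mul_comm (a _)]
  rw [← mul_assoc (_ ^ _), ← pow_add, ← Polynomial.C_mul_X_pow_eq_monomial,
    ← Polynomial.C_mul_X_pow_eq_monomial, degree_eq_zero_add_degree_tail, Polynomial.C_mul,
    Polynomial.C_pow, mul_assoc]
  simp [seqDegree, Finsupp.degree_eq_sum, Finsupp.tail_apply]

theorem monomial_sub_mem_idealHomogenization {a : Fin k → ℕ} {u v : Fin (k + 1) →₀ ℕ}
    (h : seqDegree a u.tail = seqDegree a v.tail) (hd : u.degree = v.degree) :
    monomial u (1 : K) - monomial v 1 ∈ idealHomogenization (toricIdeal K a) := by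
  classical
  rw [degree_eq_zero_add_degree_tail, degree_eq_zero_add_degree_tail] at hd
  rw [← Finsupp.cons_tail u, ← Finsupp.cons_tail v]
  generalize u 0 = u₀ at *
  generalize v 0 = v₀ at *
  generalize u.tail = α at *
  generalize v.tail = β at *
  by_cases hαβ : α = β
  · subst hαβ
    obtain rfl : u₀ = v₀ := by omega
    simp
  set f : MvPolynomial (Fin k) K := monomial α 1 - monomial β 1 with hf
  have hfα : f.coeff α = 1 := by simp [hf, coeff_monomial, Ne.symm hαβ]
  have hfβ : f.coeff β = -1 := by simp [hf, coeff_monomial, hαβ]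
  have hα : α.degree ≤ f.totalDegree := le_totalDegree (by rw [mem_support_iff, hfα]; simp)
  have hβ : β.degree ≤ f.totalDegree := le_totalDegree (by rw [mem_support_iff, hfβ]; simp)
  have hD : f.totalDegree ≤ max α.degree β.degree := by
    refine (totalDegree_sub _ _).trans ?_
    rw [totalDegree_monomial _ one_ne_zero, totalDegree_monomial _ one_ne_zero]
    rfl
  have hh : homogenization f = monomial (Finsupp.cons (f.totalDegree - α.degree) α) 1 -
      monomial (Finsupp.cons (f.totalDegree - β.degree) β) 1 := by
    rw [homogenization, Finset.sum_subset (s₂ := {α, β})]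
    · rw [Finset.sum_pair hαβ, hfα, hfβ, map_neg, sub_eq_add_neg]
    · intro γ hγ
      rw [mem_support_iff, hf, coeff_sub, coeff_monomial, coeff_monomial] at hγ
      by_contra hne
      simp only [Finset.mem_insert, Finset.mem_singleton, not_or] at hne
      simp [Ne.symm hne.1, Ne.symm hne.2] at hγ
    · intro γ _ hγ
      rw [notMem_support_iff.mp hγ, map_zero]
  have hshift : ∀ (n r : ℕ) (γ : Fin k →₀ ℕ), Finsupp.single (0 : Fin (k + 1)) n + Finsupp.cons r γ =
      Finsupp.cons (n + r) γ := by
    intro n r γ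
    ext i
    refine Fin.cases ?_ (fun j => ?_) i
    · simp
    · simp [Fin.succ_ne_zero]
  -- The given binomial is the homogenization of `f` times the surplus power of x_0.
  obtain ⟨n, hn⟩ := Nat.exists_eq_add_of_le (show f.totalDegree ≤ u₀ + α.degree by omega)
  have e : monomial (Finsupp.cons u₀ α) (1 : K) - monomial (Finsupp.cons v₀ β) 1 =
      monomial (Finsupp.single 0 n) 1 * homogenization f := by
    rw [hh, mul_sub, monomial_mul, monomial_mul, hshift, hshift, mul_one,
      show n + (f.totalDegree - α.degree) = u₀ by omega,
      show n + (f.totalDegree - β.degree) = v₀ by omega]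
  rw [e]
  exact Ideal.mul_mem_left _ _ (Ideal.subset_span
    ⟨f, monomial_sub_mem_toricIdeal h, rfl⟩)

theorem projParam_homogenization (a : Fin k → ℕ) (f : MvPolynomial (Fin k) K) :
    projParam K a (homogenization f) =
      Polynomial.C (Polynomial.X ^ f.totalDegree) *
        (aeval (fun i => (Polynomial.X : Polynomial K) ^ a i) f).map Polynomial.C := by
  conv_rhs => rw [f.as_sum, map_sum, Polynomial.map_sum, Finset.mul_sum, ← f.as_sum]
  rw [homogenization, map_sum]
  refine Finset.sum_congr rfl fun α hα => ?_
  have hle : α.degree ≤ f.totalDegree := le_totalDegree hα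
  rw [projParam_monomial, aeval_X_pow_monomial, Finsupp.tail_cons, Polynomial.map_monomial,
    Polynomial.C_mul_monomial, degree_eq_zero_add_degree_tail, Finsupp.cons_zero,
    Finsupp.tail_cons, Nat.sub_add_cancel hle, mul_comm, Polynomial.C_mul_X_pow_eq_monomial]

/-- The homogenization of the toric ideal is the kernel of the homogeneous parametrization. -/
theorem ker_projParam (a : Fin k → ℕ) :
    RingHom.ker (projParam K a) = idealHomogenization (toricIdeal K a) := by
  apply le_antisymm
  · classical
    -- One chosen monomial per bidegree; the default 0 is harmless, since only attained bidegrees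
    -- occur. Replacing each monomial by its representative changes `f` only modulo the ideal and
    -- depends only on the image of `f`.
    let r : ℕ → ℕ → Fin (k + 1) →₀ ℕ := fun h n =>
      if H : ∃ u : Fin (k + 1) →₀ ℕ, seqDegree a u.tail = h ∧ u.degree = n then H.choose else 0
    have hr : ∀ u : Fin (k + 1) →₀ ℕ, seqDegree a (r (seqDegree a u.tail) u.degree).tail = seqDegree a u.tail ∧
        (r (seqDegree a u.tail) u.degree).degree = u.degree := by
      intro u
      have H : ∃ v : Fin (k + 1) →₀ ℕ, seqDegree a v.tail = seqDegree a u.tail ∧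
          v.degree = u.degree := ⟨u, rfl, rfl⟩
      simp only [r, dif_pos H]
      exact H.choose_spec
    let Φ : Polynomial (Polynomial K) →ₗ[K] MvPolynomial (Fin (k + 1)) K :=
      Polynomial.lsum fun h => Polynomial.lsum fun n => monomial (r h n)
    have hΦ : ∀ f, f - Φ (projParam K a f) ∈ idealHomogenization (toricIdeal K a) := by
      intro f
      induction f using MvPolynomial.induction_on' with
      | monomial u c =>
        have h1 : Φ (projParam K a (monomial u c)) =
            monomial (r (seqDegree a u.tail) u.degree) c := by
          rw [projParam_monomial]
          simp [Φ, Polynomial.lsum_apply, Polynomial.sum_monomial_index]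
        have h2 : monomial u c - monomial (r (seqDegree a u.tail) u.degree) c =
            C c * (monomial u 1 - monomial (r (seqDegree a u.tail) u.degree) 1) := by
          rw [mul_sub, C_mul_monomial, C_mul_monomial, mul_one]
        rw [h1, h2]
        exact Ideal.mul_mem_left _ _
          (monomial_sub_mem_idealHomogenization (hr u).1.symm (hr u).2.symm)
      | add p q hp hq =>
        rw [map_add, map_add, add_sub_add_comm]
        exact Ideal.add_mem _ hp hq
    intro f hf
    simpa [RingHom.mem_ker.mp hf] using hΦ f
  · rw [idealHomogenization, Ideal.span_le]
    rintro _ ⟨f, hf, rfl⟩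
    rw [SetLike.mem_coe, RingHom.mem_ker, projParam_homogenization]
    have : aeval (fun i => (Polynomial.X : Polynomial K) ^ a i) f = 0 := hf
    rw [this, Polynomial.map_zero, mul_zero]

/-- The least length of a factorization of `h` in terms of the sequence `a`. -/
noncomputable def minLength (a : Fin k → ℕ) (h : ℕ) : ℕ :=
  sInf (Finsupp.degree '' {α | seqDegree a α = h})

theorem minLength_le (a : Fin k → ℕ) (α : Fin k →₀ ℕ) :
    minLength a (seqDegree a α) ≤ α.degree :=
  Nat.sInf_le ⟨α, rfl, rfl⟩

theorem exists_degree_eq_minLength {a : Fin k → ℕ} {h : ℕ} (hh : h ∈ semigroupOf a) :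
    ∃ α, seqDegree a α = h ∧ α.degree = minLength a h :=
  Nat.sInf_mem ((exists_seqDegree_eq a hh).image _)

theorem LengthIncreases.minLength_add {m : ℕ} {a : Fin (m + 1) → ℕ} (H : LengthIncreases a)
    {h : ℕ} (hh : h ∈ semigroupOf a) (n : ℕ) :
    minLength a (h + n * a (Fin.last m)) = minLength a h + n := by
  obtain ⟨α, rfl, hα⟩ := exists_degree_eq_minLength hh
  have e : seqDegree a (α + Finsupp.single (Fin.last m) n) =
      seqDegree a α + n * a (Fin.last m) := by
    rw [seqDegree_add, seqDegree_single]
  apply le_antisymm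
  · rw [← hα, ← e]
    refine (minLength_le _ _).trans_eq ?_
    rw [map_add, Finsupp.degree_single]
  · obtain ⟨β, hβ, hβ'⟩ := exists_degree_eq_minLength (e ▸ seqDegree_mem_semigroupOf a
      (α + Finsupp.single (Fin.last m) n))
    obtain ⟨γ, hγ, hle⟩ := H.iterate n α β hβ
    have := minLength_le a γ
    rw [hγ] at this
    omega

/-- A shortest factorization of h gives the least power of s beside t^h, and x_0 ↦ s supplies all
higher ones. -/
theorem mem_range_projParam_iff {a : Fin k → ℕ} {g : Polynomial (Polynomial K)} :
    g ∈ (projParam K a).range ↔ ∀ h, g.coeff h ≠ 0 →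
      h ∈ semigroupOf a ∧ Polynomial.X ^ minLength a h ∣ g.coeff h := by
  constructor
  · rintro ⟨f, rfl⟩ h hne
    change (projParam K a f).coeff h ≠ 0 at hne
    change _ ∧ _ ∣ (projParam K a f).coeff h
    rw [f.as_sum, map_sum, Polynomial.finsetSum_coeff] at hne ⊢
    simp only [projParam_monomial, Polynomial.coeff_monomial] at hne ⊢
    constructor
    · obtain ⟨u, -, hu⟩ := Finset.exists_ne_zero_of_sum_ne_zero hne
      rw [ne_eq, ite_eq_right_iff, not_forall] at hu
      obtain ⟨rfl, -⟩ := hu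
      exact seqDegree_mem_semigroupOf _ _
    · refine Finset.dvd_sum fun u _ => ?_
      split_ifs with hu
      · subst hu
        rw [← Polynomial.C_mul_X_pow_eq_monomial]
        refine Dvd.dvd.mul_left (pow_dvd_pow _ ((minLength_le _ _).trans ?_)) _
        rw [degree_eq_zero_add_degree_tail]
        omega
      · exact dvd_zero _
  · intro H
    rw [g.as_sum_support]
    refine sum_mem fun h hh => ?_
    obtain ⟨hH, p, hp⟩ := H h (Polynomial.mem_support_iff.mp hh)
    obtain ⟨α, rfl, hα⟩ := exists_degree_eq_minLength hH
    rw [hp, p.as_sum_support, Finset.mul_sum, map_sum]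
    refine sum_mem fun n _ => ⟨monomial (Finsupp.cons n α) (p.coeff n), ?_⟩
    change projParam K a _ = _
    rw [projParam_monomial, degree_eq_zero_add_degree_tail, Finsupp.tail_cons, Finsupp.cons_zero,
      hα, Polynomial.X_pow_mul_monomial]

end Parametrization

end ProjMonCurve

namespace ProjMonCurve

/-! ### Depth and regular sequences of length two. -/

section RegularSequences

open RingTheory.Sequence IsLocalRing

theorem localDepth_le_ringKrullDim (L : Type*) [CommRing L] [IsLocalRing L] [IsNoetherianRing L] :
    (localDepth L : WithBot ℕ∞) ≤ ringKrullDim L := by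
  obtain ⟨n, hn⟩ := WithBot.ne_bot_iff_exists.mp
    (ne_bot_of_le_ne_bot WithBot.zero_ne_bot (ringKrullDim_nonneg_of_nontrivial (R := L)))
  rw [← hn, WithBot.coe_le_coe]
  refine iSup_le fun rs => iSup_le fun hrs => iSup_le fun _ => ?_
  have h := ringKrullDim_add_length_eq_ringKrullDim_of_isRegular rs hrs
  have : Nontrivial (L ⧸ Ideal.ofList rs) := by
    refine Ideal.Quotient.nontrivial_iff.mpr fun htop => hrs.top_ne_smul ?_
    rw [htop, Submodule.top_smul]
  rw [← hn] at h
  rw [← WithBot.coe_le_coe, ← h]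
  exact le_add_of_nonneg_left ringKrullDim_nonneg_of_nontrivial

theorem two_le_localDepth {L : Type*} [CommRing L] [IsLocalRing L] {x y : L}
    (h : IsRegular L [x, y]) (hx : x ∈ maximalIdeal L) (hy : y ∈ maximalIdeal L) :
    2 ≤ localDepth L := by
  have := le_iSup₂_of_le (f := fun (rs : List L) (_ : IsRegular L rs) =>
    ⨆ (_ : ∀ r ∈ rs, r ∈ maximalIdeal L), (rs.length : ℕ∞)) [x, y] h
    (le_iSup_of_le (List.forall_mem_cons.mpr ⟨hx, List.forall_mem_singleton.mpr hy⟩) le_rfl)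
  exact this

theorem exists_isWeaklyRegular_of_two_le_localDepth {L : Type*} [CommRing L] [IsLocalRing L]
    (h : 2 ≤ localDepth L) :
    ∃ f ∈ maximalIdeal L, ∃ g ∈ maximalIdeal L, IsWeaklyRegular L [f, g] := by
  by_contra! hno
  have h1 : localDepth L ≤ 1 := by
    refine iSup_le fun rs => iSup_le fun hrs => iSup_le fun hmem => ?_
    match rs, hrs, hmem with
    | [], _, _ => simp
    | [_], _, _ => simp
    | f :: g :: t, hrs, hmem =>
      have hw := hrs.toIsWeaklyRegular
      refine absurd ?_ (hno f (hmem f (by simp)) g (hmem g (by simp)))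
      rw [isWeaklyRegular_cons_iff, isWeaklyRegular_cons_iff] at hw ⊢
      exact ⟨hw.1, hw.2.1, IsWeaklyRegular.nil _ _⟩
  exact absurd (h.trans h1) (by decide)

theorem isWeaklyRegular_pair_iff {L : Type*} [CommRing L] {f g : L} :
    IsWeaklyRegular L [f, g] ↔ IsSMulRegular L f ∧ ∀ r, f ∣ g * r → f ∣ r := by
  rw [isWeaklyRegular_cons_iff, isWeaklyRegular_singleton_iff]
  refine and_congr_right fun _ => (isSMulRegular_quotient_iff_mem_of_smul_mem _ _).trans ?_
  simp [Submodule.mem_smul_pointwise_iff_exists, Dvd.dvd, eq_comm]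

/-- Powers of `g` remain nonzerodivisors modulo `f`; then cancel one factor `f` at a time. -/
theorem pow_dvd_of_pow_dvd_pow_mul {L : Type*} [CommRing L] [IsDomain L] {f g : L} (hf : f ≠ 0)
    (h : ∀ r, f ∣ g * r → f ∣ r) (n l : ℕ) {r : L} (hr : f ^ n ∣ g ^ l * r) : f ^ n ∣ r := by
  have h' : ∀ l r, f ∣ g ^ l * r → f ∣ r := by
    intro l
    induction l with
    | zero => simp
    | succ l ih =>
      intro r hr
      rw [pow_succ', mul_assoc] at hr
      exact ih r (h _ hr)
  induction n generalizing r with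
  | zero => simp
  | succ n ih =>
    obtain ⟨s, rfl⟩ := h' l r ((dvd_pow_self f n.succ_ne_zero).trans hr)
    rw [pow_succ', mul_left_comm] at hr
    rw [pow_succ']
    exact mul_dvd_mul_left f (ih ((mul_dvd_mul_iff_left hf).mp hr))

/-- If the radical of `(x, y)` contains a regular sequence of length two, then every fraction
`A₀ / x = A₁ / y` lies in the ring. -/
theorem dvd_of_isWeaklyRegular_of_mem_radical {L : Type*} [CommRing L] [IsDomain L]
    {f g x y A₀ A₁ : L} (hx : x ≠ 0) (hf0 : f ≠ 0) (hfg : IsWeaklyRegular L [f, g])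
    (hf : f ∈ (Ideal.span {x, y}).radical) (hg : g ∈ (Ideal.span {x, y}).radical)
    (h : y * A₀ = x * A₁) : x ∣ A₀ := by
  obtain ⟨n, hn⟩ := hf
  obtain ⟨l, hl⟩ := hg
  obtain ⟨α, β, hn⟩ := Ideal.mem_span_pair.mp hn
  obtain ⟨γ, δ, hl⟩ := Ideal.mem_span_pair.mp hl
  -- Since f^n and g^l lie in (x, y), they multiply the fraction A₀/x into the ring. The two
  -- products are proportional, so regularity lets f^n be divided out again.
  have hF : x * (α * A₀ + β * A₁) = f ^ n * A₀ := by
    rw [← hn]; linear_combination (-β) * h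
  have hG : x * (γ * A₀ + δ * A₁) = g ^ l * A₀ := by
    rw [← hl]; linear_combination (-δ) * h
  have hFG : g ^ l * (α * A₀ + β * A₁) = f ^ n * (γ * A₀ + δ * A₁) :=
    mul_left_cancel₀ hx (by linear_combination g ^ l * hF - f ^ n * hG)
  obtain ⟨c, hc⟩ := pow_dvd_of_pow_dvd_pow_mul hf0 (isWeaklyRegular_pair_iff.mp hfg).2 n l
    ⟨_, hFG⟩
  refine ⟨c, mul_left_cancel₀ (pow_ne_zero n hf0) ?_⟩
  rw [← hF, hc]
  ring

end RegularSequences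

/-! ### Growing lengths give a Cohen-Macaulay ring. -/

section CoordinateRing

open MvPolynomial RingTheory.Sequence

variable {K R : Type*} [Field K] [CommRing R] [Algebra K R] {m : ℕ} {a : Fin (m + 1) → ℕ}
  {π : MvPolynomial (Fin (m + 1 + 1)) K →ₐ[K] R} {ι : R →ₐ[K] Polynomial (Polynomial K)}

theorem mem_range_iff_of_comp_eq (hπ : Function.Surjective π)
    (hπι : ∀ f, ι (π f) = projParam K a f) {g : Polynomial (Polynomial K)} :
    (∃ r, ι r = g) ↔ ∀ h, g.coeff h ≠ 0 →
      h ∈ semigroupOf a ∧ Polynomial.X ^ minLength a h ∣ g.coeff h := by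
  rw [← mem_range_projParam_iff]
  constructor
  · rintro ⟨r, rfl⟩
    obtain ⟨f, rfl⟩ := hπ r
    exact ⟨f, (hπι f).symm⟩
  · rintro ⟨f, rfl⟩
    exact ⟨π f, hπι f⟩

theorem X_succ_pow_eq (hι : Function.Injective ι) (hπι : ∀ f, ι (π f) = projParam K a f)
    (ha : ∀ i, a i ≤ a (Fin.last m)) (i : Fin (m + 1)) :
    π (X i.succ) ^ a (Fin.last m) =
      π (X 0) ^ (a (Fin.last m) - a i) * π (X (Fin.last m).succ) ^ a i := by
  apply hι
  rw [map_mul, map_pow, map_pow, map_pow, hπι, hπι, hπι, projParam_X_succ, projParam_X_zero,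
    projParam_X_succ, mul_pow, mul_pow, ← mul_assoc, ← pow_add, Nat.sub_add_cancel (ha i),
    ← pow_mul, ← pow_mul, mul_comm (a i)]

/-- Modulo `P` the classes of x_0 and x_n are integral over K, hence so are all x_i by
`X_succ_pow_eq`; a domain integral over a field is a field. -/
theorem isMaximal_of_aeval_mem (hπ : Function.Surjective π) (hι : Function.Injective ι)
    (hπι : ∀ f, ι (π f) = projParam K a f) (hd : 0 < a (Fin.last m))
    (ha : ∀ i, a i ≤ a (Fin.last m)) {p q : Polynomial K} (hp : p.Monic) (hq : q.Monic)
    (P : Ideal R) [P.IsPrime] (hpP : Polynomial.aeval (π (X 0)) p ∈ P)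
    (hqP : Polynomial.aeval (π (X (Fin.last m).succ)) q ∈ P) : P.IsMaximal := by
  have key : ∀ (r : R) (p : Polynomial K), p.Monic → Polynomial.aeval r p ∈ P →
      IsIntegral K (Ideal.Quotient.mkₐ K P r) := by
    intro r p hp hr
    refine ⟨p, hp, ?_⟩
    rw [← Polynomial.aeval_def, Polynomial.aeval_algHom_apply]
    exact Ideal.Quotient.eq_zero_iff_mem.mpr hr
  have hX : ∀ i, IsIntegral K (Ideal.Quotient.mkₐ K P (π (X i))) := by
    refine Fin.cases (key _ p hp hpP) fun i => IsIntegral.of_pow hd ?_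
    rw [← map_pow, X_succ_pow_eq hι hπι ha, map_mul, map_pow, map_pow]
    exact ((key _ p hp hpP).pow _).mul ((key _ q hq hqP).pow _)
  have hint : Algebra.IsIntegral K (R ⧸ P) := by
    refine ⟨fun x => ?_⟩
    obtain ⟨r, rfl⟩ := Ideal.Quotient.mkₐ_surjective K P x
    obtain ⟨f, rfl⟩ := hπ r
    induction f using MvPolynomial.induction_on with
    | C c =>
      rw [← MvPolynomial.algebraMap_eq, AlgHom.commutes, AlgHom.commutes]
      exact isIntegral_algebraMap
    | add f g hf hg => rw [map_add, map_add]; exact hf.add hg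
    | mul_X f i hf => rw [map_mul, map_mul]; exact hf.mul (hX i)
  exact Ideal.Quotient.maximal_of_isField P
    (isField_of_isIntegral_of_isField' (Field.toIsField K))

theorem aeval_C_X (p : Polynomial K) :
    Polynomial.aeval (Polynomial.C Polynomial.X : Polynomial (Polynomial K)) p =
      Polynomial.C p := by
  have := Polynomial.aeval_algHom_apply (Polynomial.CAlgHom (R := K) (A := Polynomial K))
    Polynomial.X p
  simpa using this

theorem coeff_aeval_mul (d : ℕ) (q : Polynomial K) (g : Polynomial (Polynomial K)) (h : ℕ) :
    (Polynomial.aeval (Polynomial.C Polynomial.X * Polynomial.X ^ d : Polynomial (Polynomial K)) q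
      * g).coeff (h + q.natDegree * d) = ∑ j ∈ Finset.range (q.natDegree + 1),
        q.coeff j • (Polynomial.X ^ j * g.coeff (h + (q.natDegree - j) * d)) := by
  rw [Polynomial.aeval_eq_sum_range, Finset.sum_mul, Polynomial.finsetSum_coeff]
  refine Finset.sum_congr rfl fun j hj => ?_
  have hj' : j ≤ q.natDegree := by simpa [Nat.lt_succ_iff] using hj
  obtain ⟨e, he⟩ := Nat.exists_eq_add_of_le hj'
  rw [smul_mul_assoc, Polynomial.coeff_smul, mul_pow, ← Polynomial.C_pow, ← pow_mul, mul_assoc,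
    Polynomial.coeff_C_mul,
    show h + q.natDegree * d = h + (q.natDegree - j) * d + d * j by
      rw [he, Nat.add_sub_cancel_left]; ring,
    Polynomial.coeff_X_pow_mul]

/-- If the least factorization length increases by one under adding `a_n`, then polynomials in
`x₀` and `x_n` form regular sequences in the coordinate ring. -/
theorem LengthIncreases.isWeaklyRegular_aeval (H : LengthIncreases a)
    (hπ : Function.Surjective π) (hι : Function.Injective ι)
    (hπι : ∀ f, ι (π f) = projParam K a f) (hd : 0 < a (Fin.last m))
    {p q : Polynomial K} (hp : p.Monic) (hq : q.Monic) :
    IsWeaklyRegular R [Polynomial.aeval (π (X 0)) p,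
      Polynomial.aeval (π (X (Fin.last m).succ)) q] := by
  have : IsDomain R := hι.isDomain ι.toRingHom
  have hιp : ι (Polynomial.aeval (π (X 0)) p) = Polynomial.C p := by
    rw [← Polynomial.aeval_algHom_apply, hπι, projParam_X_zero, aeval_C_X]
  have hιq : ι (Polynomial.aeval (π (X (Fin.last m).succ)) q) =
      Polynomial.aeval (Polynomial.C Polynomial.X * Polynomial.X ^ a (Fin.last m) :
        Polynomial (Polynomial K)) q := by
    rw [← Polynomial.aeval_algHom_apply, hπι, projParam_X_succ]
  have hp0 : Polynomial.aeval (π (X 0)) p ≠ 0 := by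
    intro h0
    rw [h0, map_zero, eq_comm, Polynomial.C_eq_zero] at hιp
    exact hp.ne_zero hιp
  rw [isWeaklyRegular_pair_iff]
  refine ⟨fun x y hxy => mul_left_cancel₀ hp0 hxy, ?_⟩
  rintro r ⟨r', hr⟩
  have hr := congrArg ι hr
  rw [map_mul, map_mul, hιp, hιq] at hr
  have hrange := (mem_range_iff_of_comp_eq hπ hπι).mp ⟨r, rfl⟩
  have hrange' := (mem_range_iff_of_comp_eq hπ hπι).mp ⟨r', rfl⟩
  -- Argue at the largest h where divisibility fails, comparing coefficients at h + deg(q)·a_n. The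
  -- leading term of q contributes s^{deg q} times the coefficient at h; its other terms involve
  -- only larger exponents, already settled.
  have key : ∀ h, (ι r).coeff h ≠ 0 →
      p * Polynomial.X ^ minLength a h ∣ (ι r).coeff h := by
    classical
    by_contra! hno
    obtain ⟨h₀, hh₀, hn₀⟩ := hno
    let s : Finset ℕ := (ι r).support.filter
      fun h => ¬ p * Polynomial.X ^ minLength a h ∣ (ι r).coeff h
    have hs : s.Nonempty := ⟨h₀, by simp [s, hh₀, hn₀]⟩
    obtain ⟨hh, hn⟩ : (ι r).coeff (s.max' hs) ≠ 0 ∧ ¬ p * Polynomial.X ^ minLength a (s.max' hs) ∣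
        (ι r).coeff (s.max' hs) := by
      simpa [s] using s.max'_mem hs
    have hlt : ∀ h, s.max' hs < h → p * Polynomial.X ^ minLength a h ∣ (ι r).coeff h := by
      intro h hlt
      by_contra hnd
      have : h ∈ s := by
        simp only [s, Finset.mem_filter, Polynomial.mem_support_iff]
        exact ⟨fun h0 => hnd (by rw [h0]; exact dvd_zero _), hnd⟩
      exact absurd (s.le_max' h this) (not_le.mpr hlt)
    generalize s.max' hs = h at hh hn hlt
    have hH := (hrange h hh).1
    have hc := congrArg (Polynomial.coeff · (h + q.natDegree * a (Fin.last m))) hr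
    simp only [coeff_aeval_mul, Polynomial.coeff_C_mul] at hc
    rw [Finset.sum_range_succ, hq.coeff_natDegree, one_smul, Nat.sub_self, zero_mul,
      add_zero] at hc
    have hD : Polynomial.X ^ q.natDegree * (p * Polynomial.X ^ minLength a h) ∣
        Polynomial.X ^ q.natDegree * (ι r).coeff h := by
      rw [eq_sub_of_add_eq' hc]
      refine dvd_sub ?_ (Finset.dvd_sum fun j hj => ?_)
      · rw [mul_left_comm, ← pow_add, add_comm, ← H.minLength_add hH]
        refine mul_dvd_mul_left p ?_
        by_cases h0 : (ι r').coeff (h + q.natDegree * a (Fin.last m)) = 0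
        · rw [h0]; exact dvd_zero _
        · exact (hrange' _ h0).2
      · rw [Finset.mem_range] at hj
        have h1 := hlt (h + (q.natDegree - j) * a (Fin.last m))
          (Nat.lt_add_of_pos_right (Nat.mul_pos (Nat.sub_pos_of_lt hj) hd))
        rw [H.minLength_add hH] at h1
        rw [Polynomial.smul_eq_C_mul]
        refine Dvd.dvd.mul_left ?_ _
        have e : Polynomial.X ^ q.natDegree * (p * Polynomial.X ^ minLength a h) =
            Polynomial.X ^ j * (p * Polynomial.X ^ (minLength a h + (q.natDegree - j))) := by
          rw [mul_left_comm, mul_left_comm _ p, ← pow_add, ← pow_add]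
          congr 2
          omega
        rw [e]
        exact mul_dvd_mul_left _ h1
    exact hn ((mul_dvd_mul_iff_left (pow_ne_zero _ Polynomial.X_ne_zero)).mp hD)
  obtain ⟨g, hg⟩ : Polynomial.C p ∣ ι r := by
    refine (Polynomial.C_dvd_iff_dvd_coeff _ _).mpr fun h => ?_
    by_cases h0 : (ι r).coeff h = 0
    · rw [h0]; exact dvd_zero _
    · exact (dvd_mul_right _ _).trans (key h h0)
  have hgc : ∀ h, (ι r).coeff h = p * g.coeff h := fun h => by
    rw [hg, Polynomial.coeff_C_mul]
  -- Divisibility by p alone is not enough: the power of s kept in `key` puts the quotient back in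
  -- the coordinate ring.
  obtain ⟨r₁, rfl⟩ := (mem_range_iff_of_comp_eq hπ hπι (g := g)).mpr fun h hne => by
    have h1 : (ι r).coeff h ≠ 0 := by rw [hgc]; exact mul_ne_zero hp.ne_zero hne
    have h2 := key h h1
    rw [hgc] at h2
    exact ⟨(hrange h h1).1, (mul_dvd_mul_iff_left hp.ne_zero).mp h2⟩
  exact ⟨r₁, hι (by rw [hg, map_mul, hιp])⟩

theorem exists_monic_aeval_mem [Algebra.FiniteType K R] (𝔪 : Ideal R) [𝔪.IsMaximal] (r : R) :
    ∃ p : Polynomial K, p.Monic ∧ Polynomial.aeval r p ∈ 𝔪 := by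
  let := Ideal.Quotient.field 𝔪
  have : Module.Finite K (R ⧸ 𝔪) := finite_of_finite_type_of_isJacobsonRing K (R ⧸ 𝔪)
  obtain ⟨p, hp, hr⟩ := Algebra.IsIntegral.isIntegral (R := K) (Ideal.Quotient.mkₐ K 𝔪 r)
  rw [← Polynomial.aeval_def, Polynomial.aeval_algHom_apply] at hr
  exact ⟨p, hp, Ideal.Quotient.eq_zero_iff_mem.mp hr⟩

/-- Each maximal ideal contains monic polynomials in x_0 and in x_n. They form a regular sequence,
and the ideal is minimal over them, so Krull's height theorem bounds the dimension by two. -/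
theorem LengthIncreases.isCohenMacaulayRing (H : LengthIncreases a)
    (hπ : Function.Surjective π) (hι : Function.Injective ι)
    (hπι : ∀ f, ι (π f) = projParam K a f) (hd : 0 < a (Fin.last m))
    (ha : ∀ i, a i ≤ a (Fin.last m)) : IsCohenMacaulayRing R := by
  have hnoeth : IsNoetherianRing R := isNoetherianRing_of_surjective _ _ π.toRingHom hπ
  have : Algebra.FiniteType K R := Algebra.FiniteType.of_surjective π hπ
  refine ⟨hnoeth, fun 𝔪 _ => ?_⟩
  obtain ⟨p, hp, hpm⟩ := exists_monic_aeval_mem (K := K) 𝔪 (π (X 0))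
  obtain ⟨q, hq, hqm⟩ := exists_monic_aeval_mem (K := K) 𝔪 (π (X (Fin.last m).succ))
  have hreg := (H.isWeaklyRegular_aeval hπ hι hπι hd hp hq).isRegular_of_isLocalization_of_mem
    (Localization.AtPrime 𝔪) 𝔪 (List.forall_mem_cons.mpr ⟨hpm, List.forall_mem_singleton.mpr hqm⟩)
  have : IsNoetherianRing (Localization.AtPrime 𝔪) :=
    IsLocalization.isNoetherianRing 𝔪.primeCompl _ hnoeth
  have hdepth := two_le_localDepth hreg
    ((IsLocalization.AtPrime.to_map_mem_maximal_iff _ 𝔪 _).mpr hpm)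
    ((IsLocalization.AtPrime.to_map_mem_maximal_iff _ 𝔪 _).mpr hqm)
  refine le_antisymm (localDepth_le_ringKrullDim _) (le_trans ?_ (WithBot.coe_le_coe.mpr hdepth))
  rw [IsLocalization.AtPrime.ringKrullDim_eq_height 𝔪, WithBot.coe_le_coe]
  set x := Polynomial.aeval (π (X 0)) p
  set y := Polynomial.aeval (π (X (Fin.last m).succ)) q
  have hmin : 𝔪 ∈ (Ideal.span {x, y}).minimalPrimes := by
    refine ⟨⟨inferInstance, ?_⟩, fun P hP hle => ?_⟩
    · rw [Ideal.span_le]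
      rintro z (rfl | rfl)
      exacts [hpm, hqm]
    · have := hP.1
      have hPmax := isMaximal_of_aeval_mem hπ hι hπι hd ha hp hq P
        (hP.2 (Ideal.subset_span (.inl rfl))) (hP.2 (Ideal.subset_span (.inr rfl)))
      exact (hPmax.eq_of_le (Ideal.IsPrime.ne_top inferInstance) hle).ge
  refine (Ideal.height_le_card_of_mem_minimalPrimes_span (Set.toFinite _) hmin).trans ?_
  exact_mod_cast Set.ncard_insert_le x {y} |>.trans (by simp)

end CoordinateRing

end ProjMonCurve

namespace ProjMonCurve

/-! ### A Cohen-Macaulay ring forces lengths to grow. -/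

section CoordinateRing

open MvPolynomial RingTheory.Sequence

variable {K R : Type*} [Field K] [CommRing R] [Algebra K R] {m : ℕ} {a : Fin (m + 1) → ℕ}
  {π : MvPolynomial (Fin (m + 1 + 1)) K →ₐ[K] R} {ι : R →ₐ[K] Polynomial (Polynomial K)}

/-- The value of a polynomial in `K[s][t]` at the origin. -/
noncomputable def evalOrigin (K : Type*) [Field K] : Polynomial (Polynomial K) →ₐ[K] K :=
  (Polynomial.aeval (0 : K)).comp
    ((Polynomial.aeval (R := Polynomial K) (0 : Polynomial K)).restrictScalars K)

theorem evalOrigin_apply (f : Polynomial (Polynomial K)) :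
    evalOrigin K f = (f.coeff 0).coeff 0 := by
  simp [evalOrigin, Polynomial.coe_aeval_eq_eval, Polynomial.coeff_zero_eq_eval_zero]

/-- The vertex of the affine cone over the projective monomial curve. -/
noncomputable def vertexIdeal (ι : R →ₐ[K] Polynomial (Polynomial K)) : Ideal R :=
  RingHom.ker ((evalOrigin K).comp ι)

instance (ι : R →ₐ[K] Polynomial (Polynomial K)) : (vertexIdeal ι).IsMaximal :=
  RingHom.ker_isMaximal_of_surjective _ fun c => ⟨algebraMap K R c, AlgHom.commutes _ c⟩

theorem mem_vertexIdeal_iff {r : R} : r ∈ vertexIdeal ι ↔ ((ι r).coeff 0).coeff 0 = 0 := by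
  rw [← evalOrigin_apply]
  rfl

theorem evalOrigin_projParam (f : MvPolynomial (Fin (m + 1 + 1)) K)
    (ha_pos : ∀ i, 0 < a i) : evalOrigin K (projParam K a f) = constantCoeff f := by
  suffices (evalOrigin K).comp (projParam K a) = aeval 0 by
    have := DFunLike.congr_fun this f
    simpa [aeval_zero] using this
  refine algHom_ext fun i => ?_
  rw [AlgHom.comp_apply, evalOrigin_apply, aeval_X]
  refine Fin.cases ?_ (fun i => ?_) i
  · simp [projParam_X_zero]
  · simp [projParam_X_succ, (ha_pos i).ne, Polynomial.coeff_X_pow]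

theorem vertexIdeal_le_radical (hπ : Function.Surjective π) (hι : Function.Injective ι)
    (hπι : ∀ f, ι (π f) = projParam K a f) (ha_pos : ∀ i, 0 < a i)
    (ha : ∀ i, a i ≤ a (Fin.last m)) :
    vertexIdeal ι ≤ (Ideal.span {π (X 0), π (X (Fin.last m).succ)}).radical := by
  have hX : ∀ i, π (X i) ∈ (Ideal.span {π (X 0), π (X (Fin.last m).succ)}).radical := by
    refine Fin.cases (Ideal.le_radical (Ideal.subset_span (.inl rfl))) fun i =>
      ⟨a (Fin.last m), ?_⟩
    rw [X_succ_pow_eq hι hπι ha]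
    exact Ideal.mul_mem_left _ _ (Ideal.pow_mem_of_mem _ (Ideal.subset_span (.inr rfl)) _
      (ha_pos i))
  intro r hr
  obtain ⟨f, rfl⟩ := hπ r
  rw [mem_vertexIdeal_iff, ← evalOrigin_apply, hπι, evalOrigin_projParam f ha_pos,
    constantCoeff_eq, ← notMem_support_iff] at hr
  rw [f.as_sum, map_sum]
  refine sum_mem fun u hu => ?_
  obtain ⟨i, hi⟩ := Finsupp.ne_iff.mp (fun h0 => hr (h0 ▸ hu) : u ≠ 0)
  have hdvd : X i ∣ monomial u (f.coeff u) := X_dvd_monomial.mpr (.inr hi)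
  exact Ideal.mem_of_dvd _ (map_dvd π hdvd) (hX i)

/-- The locus t = 0 gives a prime strictly between zero and the vertex: it contains x_n but not x_0.
-/
theorem two_le_height_vertexIdeal (hι : Function.Injective ι)
    (hπι : ∀ f, ι (π f) = projParam K a f) (ha_pos : ∀ i, 0 < a i) :
    2 ≤ (vertexIdeal ι).height := by
  have : IsDomain R := hι.isDomain ι.toRingHom
  let P : Ideal R := RingHom.ker ((Polynomial.evalRingHom (0 : Polynomial K)).comp ι.toRingHom)
  have hP : P.IsPrime := RingHom.ker_isPrime _
  have memP : ∀ r, r ∈ P ↔ (ι r).coeff 0 = 0 := fun r => by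
    rw [Polynomial.coeff_zero_eq_eval_zero]
    rfl
  have h1 : ⊥ < P := by
    refine bot_lt_iff_ne_bot.mpr fun h => ?_
    have hmem : π (X (Fin.last m).succ) ∈ P := by
      rw [memP, hπι, projParam_X_succ]
      simp [Polynomial.coeff_X_pow, (ha_pos (Fin.last m)).ne]
    rw [h, Ideal.mem_bot] at hmem
    have := hπι (X (Fin.last m).succ)
    rw [hmem, map_zero, projParam_X_succ] at this
    simp at this
  have h2 : P < vertexIdeal ι := by
    refine lt_of_le_of_ne (fun r hr => ?_) fun h => ?_
    · rw [mem_vertexIdeal_iff, (memP r).mp hr, Polynomial.coeff_zero]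
    · have hmem : π (X 0) ∈ vertexIdeal ι := by
        rw [mem_vertexIdeal_iff, hπι, projParam_X_zero]
        simp
      rw [← h, memP, hπι, projParam_X_zero] at hmem
      simp at hmem
  have e1 := Ideal.height_add_one_le_of_lt_of_isPrime h1
  have e2 := Ideal.height_add_one_le_of_lt_of_isPrime h2
  calc (2 : ℕ∞) = 0 + 1 + 1 := by norm_num
    _ ≤ (⊥ : Ideal R).height + 1 + 1 := by gcongr; exact zero_le
    _ ≤ P.height + 1 := by gcongr
    _ ≤ _ := e2

theorem lengthIncreases_of_isCohenMacaulayRing (hπ : Function.Surjective π)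
    (hι : Function.Injective ι) (hπι : ∀ f, ι (π f) = projParam K a f) (ha_pos : ∀ i, 0 < a i)
    (ha : ∀ i, a i ≤ a (Fin.last m)) (hR : IsCohenMacaulayRing R) : LengthIncreases a := by
  have : IsDomain R := hι.isDomain ι.toRingHom
  intro γ β hβ
  by_contra! hno
  set d := a (Fin.last m)
  set g := seqDegree a γ
  have hd : 0 < d := ha_pos _
  obtain ⟨α, hα, hαl⟩ := exists_degree_eq_minLength (seqDegree_mem_semigroupOf a γ)
  have hle : β.degree ≤ minLength a g := hαl ▸ hno α hα
  have hβ0 : 0 < β.degree := by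
    refine Nat.pos_of_ne_zero fun h0 => ?_
    rw [(Finsupp.degree_eq_zero_iff _).mp h0, seqDegree_zero] at hβ
    omega
  obtain ⟨l, hl⟩ := Nat.exists_eq_succ_of_ne_zero (hβ0.trans_le hle).ne'
  have hmon : ∀ h, h ∈ semigroupOf a → minLength a h ≤ l + 1 →
      ∃ r, ι r = Polynomial.monomial h (Polynomial.X ^ (l + 1)) := by
    intro h hh hlen
    rw [mem_range_iff_of_comp_eq hπ hπι]
    intro h' hne
    rw [Polynomial.coeff_monomial] at hne ⊢
    split_ifs at hne ⊢ with e
    · subst e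
      exact ⟨hh, pow_dvd_pow _ hlen⟩
    · exact absurd rfl hne
  -- Failure of growth puts both s^{l+1} t^g and s^{l+1} t^{g+d} in the ring, so A₀/x_0 = A₁/x_n is
  -- the fraction s^l t^g, one power of s short of belonging to it.
  obtain ⟨A₀, hA₀⟩ := hmon g (seqDegree_mem_semigroupOf a γ) hl.le
  obtain ⟨A₁, hA₁⟩ := hmon (g + d) (hβ ▸ seqDegree_mem_semigroupOf a β)
    (hβ ▸ (minLength_le a β).trans (hle.trans hl.le))
  set x := π (X 0) with hxdef
  set y := π (X (Fin.last m).succ) with hydef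
  have hx : ι x = Polynomial.C Polynomial.X := by rw [hxdef, hπι, projParam_X_zero]
  have hy : ι y = Polynomial.C Polynomial.X * Polynomial.X ^ d := by
    rw [hydef, hπι, projParam_X_succ]
  have hx0 : x ≠ 0 := fun h => by
    rw [h, map_zero, eq_comm, Polynomial.C_eq_zero] at hx
    exact Polynomial.X_ne_zero hx
  have hA : y * A₀ = x * A₁ := hι <| by
    rw [map_mul, map_mul, hx, hy, hA₀, hA₁, mul_assoc, Polynomial.X_pow_mul_monomial]
  let L := Localization.AtPrime (vertexIdeal ι)
  have hinj : Function.Injective (algebraMap R L) :=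
    IsLocalization.injective L (vertexIdeal ι).primeCompl_le_nonZeroDivisors
  have : IsDomain L := IsLocalization.isDomain_localization
    (vertexIdeal ι).primeCompl_le_nonZeroDivisors
  have hdepth : 2 ≤ localDepth L := by
    rw [← WithBot.coe_le_coe, hR.depth_eq_dim (vertexIdeal ι),
      IsLocalization.AtPrime.ringKrullDim_eq_height (vertexIdeal ι), WithBot.coe_le_coe]
    exact two_le_height_vertexIdeal hι hπι ha_pos
  obtain ⟨f₁, hf₁, f₂, hf₂, hreg⟩ := exists_isWeaklyRegular_of_two_le_localDepth hdepth
  have hrad : IsLocalRing.maximalIdeal L ≤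
      (Ideal.span {algebraMap R L x, algebraMap R L y}).radical := by
    rw [← Localization.AtPrime.map_eq_maximalIdeal]
    refine (Ideal.map_mono (vertexIdeal_le_radical hπ hι hπι ha_pos ha)).trans
      ((Ideal.map_radical_le _).trans (Ideal.radical_mono ?_))
    rw [Ideal.map_span, Set.image_pair]
  have hf₁0 : f₁ ≠ 0 := by
    rintro rfl
    exact one_ne_zero ((isWeaklyRegular_pair_iff.mp hreg).1 (a₁ := 1) (a₂ := 0) (by simp))
  obtain ⟨z, hz⟩ := dvd_of_isWeaklyRegular_of_mem_radical
    (fun h => hx0 (hinj (h.trans (map_zero _).symm))) hf₁0 hreg (hrad hf₁) (hrad hf₂)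
    (A₀ := algebraMap R L A₀) (A₁ := algebraMap R L A₁) (by rw [← map_mul, hA, map_mul])
  obtain ⟨⟨c, σ⟩, hσ⟩ := IsLocalization.surj (vertexIdeal ι).primeCompl z
  have hσ' : A₀ * σ = x * c := hinj (by
    rw [map_mul, map_mul, hz, mul_assoc, hσ])
  have hw : Polynomial.monomial g (Polynomial.X ^ l) * ι σ = ι c := by
    have := congrArg ι hσ'
    rw [map_mul, map_mul, hA₀, hx, pow_succ', ← Polynomial.C_mul_monomial, mul_assoc] at this
    exact mul_left_cancel₀ (by simp) this
  have hcoeff : (ι c).coeff g = Polynomial.X ^ l * (ι σ).coeff 0 := by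
    have := Polynomial.coeff_monomial_mul (ι σ) g 0 (Polynomial.X ^ l)
    rwa [hw, zero_add] at this
  -- The coefficient of t^g in `c` is s^l times the t-constant term of `σ`, yet must be divisible by
  -- s^{l+1}; so the denominator vanishes at the vertex.
  refine σ.2 (mem_vertexIdeal_iff.mpr ?_)
  rw [← Polynomial.X_dvd_iff]
  by_cases h0 : (ι c).coeff g = 0
  · rw [h0, eq_comm, mul_eq_zero] at hcoeff
    rw [hcoeff.resolve_left (by simp)]
    exact dvd_zero _
  · have := ((mem_range_iff_of_comp_eq hπ hπι).mp ⟨c, rfl⟩ g h0).2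
    rw [hl, hcoeff, pow_succ] at this
    exact (mul_dvd_mul_iff_left (pow_ne_zero _ Polynomial.X_ne_zero)).mp this

end CoordinateRing

theorem isArithmeticallyCohenMacaulay_iff_lengthIncreases (K : Type*) [Field K] {m : ℕ}
    {a : Fin (m + 1) → ℕ} (ha_pos : ∀ i, 0 < a i) (ha : ∀ i, a i ≤ a (Fin.last m)) :
    IsArithmeticallyCohenMacaulay K a ↔ LengthIncreases a := by
  let J := idealHomogenization (toricIdeal K a)
  have hJ : RingHom.ker (projParam K a) = J := ker_projParam a
  let π := Ideal.Quotient.mkₐ K J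
  let ι : (MvPolynomial (Fin (m + 1 + 1)) K ⧸ J) →ₐ[K] Polynomial (Polynomial K) :=
    Ideal.Quotient.liftₐ J (projParam K a) fun f hf => by rwa [← hJ] at hf
  have hπ : Function.Surjective π := Ideal.Quotient.mkₐ_surjective K J
  have hπι : ∀ f, ι (π f) = projParam K a f := fun f => rfl
  have hι : Function.Injective ι := by
    rw [injective_iff_map_eq_zero]
    intro r hr
    obtain ⟨f, rfl⟩ := hπ r
    refine Ideal.Quotient.eq_zero_iff_mem.mpr ?_
    rw [← hJ]
    exact hr
  exact ⟨fun h => lengthIncreases_of_isCohenMacaulayRing hπ hι hπι ha_pos ha h,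
    fun h => h.isCohenMacaulayRing hπ hι hπι (ha_pos _) ha⟩

end ProjMonCurve

theorem theorem2p6 (K : Type*) [Field K] (m : ℕ) (a : Fin (m + 1) → ℕ)
    (ha_pos : ∀ i, 0 < a i) (ha_distinct : Function.Injective a)
    (ha_gcd : Finset.univ.gcd a = 1)
    (ha_last : ∀ i, i ≠ Fin.last m → a i < a (Fin.last m)) :
    List.TFAE [
      IsArithmeticallyCohenMacaulay K a,
      initialIdeal (degRevLex (m + 1))
          (Ideal.span {MvPolynomial.X (Fin.last m)} ⊔ toricIdeal K a) =
        initialIdeal (degRevLex (m + 1))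
          (Ideal.span {MvPolynomial.X (Fin.last m)} ⊔ toricIdeal K (dualSeq a)),
      standardMonomials (initialIdeal (degRevLex (m + 1))
          (Ideal.span {MvPolynomial.X (Fin.last m)} ⊔ toricIdeal K a)) =
        standardMonomials (initialIdeal (degRevLex (m + 1))
          (Ideal.span {MvPolynomial.X (Fin.last m)} ⊔ toricIdeal K (dualSeq a))),
      ∀ (h : ℕ) (hh : h ∈ aperySet (semigroupOf a) (a (Fin.last m))),
        seqDegree (dualSeq a) (smallestMonomial a h hh.1) ∈
          aperySet (semigroupOf (dualSeq a)) (a (Fin.last m))] := by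
  have hd := ha_pos (Fin.last m)
  have ha : ∀ i, a i ≤ a (Fin.last m) := fun i => by
    rcases eq_or_ne i (Fin.last m) with rfl | h
    · exact le_rfl
    · exact (ha_last i h).le
  tfae_have 2 ↔ 3 := initialIdeal_eq_iff_standardMonomials_eq
  tfae_have 3 ↔ 4 := by
    rw [forall_aperySet_iff a fun α => seqDegree (dualSeq a) α ∈
      aperySet (semigroupOf (dualSeq a)) (a (Fin.last m)),
      ← forall_isAperyMinimal_dualSeq_iff hd ha, Set.ext_iff]
    simp_rw [mem_standardMonomials_iff]
  tfae_have 1 ↔ 4 := by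
    rw [forall_aperySet_iff a fun α => seqDegree (dualSeq a) α ∈
      aperySet (semigroupOf (dualSeq a)) (a (Fin.last m)),
      forall_dualSeq_mem_aperySet_iff_lengthIncreases hd ha,
      isArithmeticallyCohenMacaulay_iff_lengthIncreases K ha_pos ha]
  tfae_finish
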